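/- **Setting.** Consider a $1$–$N$ generalized Stackelberg game $\Gamma$. The leader chooses $\mathbf y\in\Omega_{\mathrm L}=\{\mathbf y\in\mathbb R^{n_{\mathrm L}} : h_{\mathrm L}^j(\mathbf y)\le 0\ (j\le p_{\mathrm L}),\ l_{\mathrm L}^k(\mathbf y)=0\ (k\le q_{\mathrm L})\}$ to maximize $f_{\mathrm L}(\mathbf y,\mathbf x)$. Follower $i\in\{1,\dots,N\}$ chooses $\mathbf x_i\in\Omega_i(\mathbf y,\mathbf x_{-i})=\{\mathbf x_i\in\mathbb R^{n_i}: h_i^j(\mathbf y,\mathbf x)\le 0\ (j\le p_i),\ l_i^k(\mathbf y,\mathbf x)=0\ (k\le q_i)\}$ to maximize $f_i(\mathbf y,\mathbf x)$, where $\mathbf x=(\mathbf x_1,\dots,\mathbf x_N)$. Let $K(\mathbf y)=\{\mathbf x : \mathbf x_i\in\Omega_i(\mathbf y,\mathbf x_{-i})\ \forall i\}$ and $\mathbf D(\mathbf y,\mathbf x)=(\nabla_{\mathbf x_i}f_i(\mathbf y,\mathbf x))_{i}$. Let $\mathrm{VE}(\mathbf y)$ be the set of $\mathbf x\in K(\mathbf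 y)$ with $\mathbf D(\mathbf y,\mathbf x)^{\mathrm T}(\mathbf x-\mathbf x')\ge 0$ for all $\mathbf x'\in K(\mathbf y)$ (variational equilibria). A *variational Stackelberg equilibrium* of $\Gamma$ is a pair $(\mathbf y^*,\mathbf x^*)$ with $\mathbf y^*\in\Omega_{\mathrm L}$, $\mathbf x^*\in \mathrm{VE}(\mathbf y^*)$ and $$\sup_{\mathbf x\in \mathrm{VE}(\mathbf y^*)}f_{\mathrm L}(\mathbf y^*,\mathbf x)\ \ge\ \inf_{\mathbf x\in \mathrm{VE}(\mathbf y)}f_{\mathrm L}(\mathbf y,\mathbf x)\qquad\text{for all }\mathbf y\in\Omega_{\mathrm L},$$ with suprema and infima in $[-\infty,\infty]$. The $1$–$1$ Stackelberg game $\hat\Gamma$ has the same leader set $\Omega_{\mathrm L}$, and a single follower who chooses $\mathbf w=(\mathbf x,\mathbf z,\boldsymbol\lambda,\boldsymbol\mu)$ to maximize $f_{\mathrm F}(\mathbf y,\mathbf w)=\mathbf D(\mathbf y,\mathbf x)^{\mathrm T}(\mathbf x-\mathbf z)$ over the set $\Omega_{\mathrm F}(\mathbf y)$ of all $\mathbf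 w$ such that $$-\mathbf D(\mathbf y,\mathbf x)+\sum_{i,j}\lambda_i^j\nabla_{\mathbf z}h_i^j(\mathbf y,\mathbf z)+\sum_{i,k}\mu_i^k\nabla_{\mathbf z}l_i^k(\mathbf y,\mathbf z)=\mathbf 0$$ and, for all $i,j,k$, $h_i^j(\mathbf y,\mathbf x)\le0$, $l_i^k(\mathbf y,\mathbf x)=0$, $\lambda_i^jh_i^j(\mathbf y,\mathbf z)=0$, $h_i^j(\mathbf y,\mathbf z)\le 0$, $l_i^k(\mathbf y,\mathbf z)=0$, $\lambda_i^j\ge0$. The leader's objective is $f_{\mathrm L}(\mathbf y,\mathbf x)$, with $\mathbf x$ the first component of $\mathbf w$. Let $\mathrm{BR}(\mathbf y)=\operatorname{argmax}_{\mathbf w\in\Omega_{\mathrm F}(\mathbf y)}f_{\mathrm F}(\mathbf y,\mathbf w)$. A *Stackelberg equilibrium* of $\hat\Gamma$ is a pair $(\mathbf y^*,\mathbf w^*)$ with $\mathbf y^*\in\Omega_{\mathrm L}$, $\mathbf w^*\in\mathrm{BR}(\mathbf y^*)$ and $\sup_{\mathbf w\in\mathrm{BR}(\mathbf y^*)}f_{\mathrm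 L}(\mathbf y^*,\mathbf x)\ge\inf_{\mathbf w\in\mathrm{BR}(\mathbf y)}f_{\mathrm L}(\mathbf y,\mathbf x)$ for all $\mathbf y\in\Omega_{\mathrm L}$. **Theorem 4.** Suppose that for every $\mathbf y\in\Omega_{\mathrm L}$: 1. for all $\mathbf x\in K(\mathbf y)$ and all $i$, $\Omega_i(\mathbf y,\mathbf x_{-i})$ is closed and convex; 2. for all $\mathbf x\in K(\mathbf y)$ and all $i$, $f_i(\mathbf y,\cdot,\mathbf x_{-i})$ is concave on $\Omega_i(\mathbf y,\mathbf x_{-i})$, and $f_i(\mathbf y,\cdot)$ is $C^1$ in a neighbourhood of each point of $K(\mathbf y)$; 3. $K(\mathbf y)$ is convex; 4. $-\mathbf D(\mathbf y,\cdot)$ is strongly monotone on $K(\mathbf y)$; 5. all functions $h_i^j(\mathbf y,\cdot)$ and $l_i^k(\mathbf y,\cdot)$ are differentiable, and Abadie's constraint qualification holds at every $\mathbf z\in K(\mathbf y)$: every direction $\mathbf d$ with $\nabla_{\mathbf z}h_i^j(\mathbf y,\mathbf z)^{\mathrm T}\mathbf d\le0$ for all active inequality constraints ($h_i^j(\mathbf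 y,\mathbf z)=0$) and $\nabla_{\mathbf z}l_i^k(\mathbf y,\mathbf z)^{\mathrm T}\mathbf d=0$ for all $i,k$ lies in the (Bouligand) tangent cone of $K(\mathbf y)$ at $\mathbf z$. Then the set of variational Stackelberg equilibria of $\Gamma$ equals the set of Stackelberg equilibria of $\hat\Gamma$, where $(\mathbf y,\mathbf w)$ with $\mathbf w=(\mathbf x,\mathbf z,\boldsymbol\lambda,\boldsymbol\mu)$ is identified with its decision part $(\mathbf y,\mathbf x)$; that is, $$\{\text{variational Stackelberg equilibria of }\Gamma\}=\{(\mathbf y,\mathbf x) : (\mathbf y,(\mathbf x,\mathbf z,\boldsymbol\lambda,\boldsymbol\mu))\text{ is a Stackelberg equilibrium of }\hat\Gamma\text{ for some }\mathbf z,\boldsymbol\lambda,\boldsymbol\mu\}.$$ -/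

import Mathlib

/-! # One-leader / many-follower generalized Stackelberg games and their single-follower reformulation -/

namespace Stackelberg

noncomputable section

/-- Joint decisions `x = (x₁, …, x_N)` of the followers, with `xᵢ ∈ ℝ^{nᵢ}`. -/
abbrev Profile {N : ℕ} (n : Fin N → ℕ) : Type :=
  (i : Fin N) → EuclideanSpace ℝ (Fin (n i))

/-- The Euclidean inner product `uᵀ v` on `ℝ^{n₁ + ⋯ + n_N}`, computed block by block. -/
def dot {N : ℕ} {n : Fin N → ℕ} (u v : Profile n) : ℝ :=
  ∑ i, inner ℝ (u i) (v i)

/-- The partial gradient `∇_{xᵢ} g (x) ∈ ℝ^{nᵢ}` with respect to the `i`-th block. -/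
def partialGrad {N : ℕ} {n : Fin N → ℕ} (g : Profile n → ℝ) (x : Profile n) (i : Fin N) :
    EuclideanSpace ℝ (Fin (n i)) :=
  gradient (fun u : EuclideanSpace ℝ (Fin (n i)) => g (Function.update x i u)) (x i)

/-- The gradient `∇ₓ g (x) = (∇_{xᵢ} g (x))ᵢ` with respect to the joint decision. -/
def fullGrad {N : ℕ} {n : Fin N → ℕ} (g : Profile n → ℝ) (x : Profile n) : Profile n :=
  fun i => partialGrad g x i

/-- Data of a `1-N` generalized Stackelberg game: the leader has decisions in `ℝ^{nL}`, `pL`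
inequality and `qL` equality constraints; follower `i` has decisions in `ℝ^{nᵢ}`, `pᵢ` inequality
and `qᵢ` equality constraints, which may involve the decisions of the leader and of all
followers. All players maximize. -/
structure MultiFollowerGame (N nL pL qL : ℕ) (n p q : Fin N → ℕ) where
  /-- objective of the leader -/
  fL : EuclideanSpace ℝ (Fin nL) → Profile n → ℝ
  /-- objectives of the followers -/
  f : Fin N → EuclideanSpace ℝ (Fin nL) → Profile n → ℝ
  /-- inequality constraints of the leader -/
  hL : Fin pL → EuclideanSpace ℝ (Fin nL) → ℝ
  /-- equality constraints of the leader -/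
  lL : Fin qL → EuclideanSpace ℝ (Fin nL) → ℝ
  /-- inequality constraints of the followers -/
  h : (i : Fin N) → Fin (p i) → EuclideanSpace ℝ (Fin nL) → Profile n → ℝ
  /-- equality constraints of the followers -/
  l : (i : Fin N) → Fin (q i) → EuclideanSpace ℝ (Fin nL) → Profile n → ℝ

/-- Data of a `1-1` Stackelberg game: decision spaces `Y` (leader) and `W` (follower), objectives
(both players maximize), strategy set of the leader, and strategy set of the follower, which
depends on the decision of the leader. -/
structure SingleFollowerGame (Y W : Type*) where
  /-- objective of the leader -/
  fL : Y → W → ℝ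
  /-- objective of the follower -/
  fF : Y → W → ℝ
  /-- strategy set of the leader -/
  leaderSet : Set Y
  /-- strategy set of the follower -/
  followerSet : Y → Set W

namespace SingleFollowerGame

variable {Y W : Type*} (G : SingleFollowerGame Y W)

/-- The follower's optimal responses `argmax_{w ∈ Ω_F(y)} f_F(y, w)`. -/
def bestResponses (y : Y) : Set W :=
  {w | w ∈ G.followerSet y ∧ ∀ w' ∈ G.followerSet y, G.fF y w' ≤ G.fF y w}

/-- The Stackelberg equilibria: pairs `(y, w)` with `y ∈ Ω_L`, `w` an optimal response to `y`, and
`sup_{v ∈ BR(y)} f_L(y, v) ≥ inf_{v ∈ BR(y')} f_L(y', v)` for all `y' ∈ Ω_L`. Suprema and infima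
are taken in the extended reals. -/
def stackelbergEquilibria : Set (Y × W) :=
  {e | e.1 ∈ G.leaderSet ∧ e.2 ∈ G.bestResponses e.1 ∧
    ∀ y' ∈ G.leaderSet,
      (⨅ v ∈ G.bestResponses y', (G.fL y' v : EReal)) ≤
        ⨆ v ∈ G.bestResponses e.1, (G.fL e.1 v : EReal)}

end SingleFollowerGame

/-- Decisions `w = (x, z, λ, μ)` of the fictitious follower. -/
structure FollowerDecision {N : ℕ} (n p q : Fin N → ℕ) where
  /-- joint decision of the original followers -/
  x : Profile n
  /-- decision of the inner minimization problem -/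
  z : Profile n
  /-- multipliers of the inequality constraints -/
  lam : (i : Fin N) → Fin (p i) → ℝ
  /-- multipliers of the equality constraints -/
  mu : (i : Fin N) → Fin (q i) → ℝ

namespace MultiFollowerGame

variable {N nL pL qL : ℕ} {n p q : Fin N → ℕ} (G : MultiFollowerGame N nL pL qL n p q)

/-- The strategy set `Ω_L` of the leader. -/
def leaderSet : Set (EuclideanSpace ℝ (Fin nL)) :=
  {y | (∀ j, G.hL j y ≤ 0) ∧ ∀ k, G.lL k y = 0}

/-- The strategy set `Ωᵢ(y, x₋ᵢ)` of follower `i` (the `i`-th block of `x` is not used). -/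
def strategySet (i : Fin N) (y : EuclideanSpace ℝ (Fin nL)) (x : Profile n) :
    Set (EuclideanSpace ℝ (Fin (n i))) :=
  {u | (∀ j, G.h i j y (Function.update x i u) ≤ 0) ∧
    ∀ k, G.l i k y (Function.update x i u) = 0}

/-- The joint feasible set: profiles `x` with `x ∈ ∏ᵢ Ωᵢ(y, x₋ᵢ)`. -/
def jointSet (y : EuclideanSpace ℝ (Fin nL)) : Set (Profile n) :=
  {x | ∀ i, x i ∈ G.strategySet i y x}

/-- `D(y, x) = (∇_{xᵢ} fᵢ(y, x))ᵢ`, the joint gradient of the followers' objectives. -/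
def pseudoGrad (y : EuclideanSpace ℝ (Fin nL)) (x : Profile n) : Profile n :=
  fun i => partialGrad (G.f i y) x i

/-- The variational equilibria of the followers' subgame at the leader's decision `y`. -/
def variationalEquilibria (y : EuclideanSpace ℝ (Fin nL)) : Set (Profile n) :=
  {x | x ∈ G.jointSet y ∧ ∀ x' ∈ G.jointSet y, 0 ≤ dot (G.pseudoGrad y x) (x - x')}

/-- The variational Stackelberg equilibria: pairs `(y, x)` with `y ∈ Ω_L`, `x ∈ VE(y)` and
`sup_{v ∈ VE(y)} f_L(y, v) ≥ inf_{v ∈ VE(y')} f_L(y', v)` for all `y' ∈ Ω_L`. Suprema and infima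
are taken in the extended reals. -/
def variationalStackelbergEquilibria : Set (EuclideanSpace ℝ (Fin nL) × Profile n) :=
  {e | e.1 ∈ G.leaderSet ∧ e.2 ∈ G.variationalEquilibria e.1 ∧
    ∀ y' ∈ G.leaderSet,
      (⨅ v ∈ G.variationalEquilibria y', (G.fL y' v : EReal)) ≤
        ⨆ v ∈ G.variationalEquilibria e.1, (G.fL e.1 v : EReal)}

/-- The strategy set `Ω_F(y)` of the fictitious follower: the original constraints on `x`, and the
KKT system at `z` of the problem of minimizing `D(y, x)ᵀ (x - z)` over `z ∈ ∏ᵢ Ωᵢ(y, z₋ᵢ)`. -/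
def kktSet (y : EuclideanSpace ℝ (Fin nL)) : Set (FollowerDecision n p q) :=
  {w | -G.pseudoGrad y w.x + (∑ i, ∑ j, w.lam i j • fullGrad (G.h i j y) w.z)
        + (∑ i, ∑ k, w.mu i k • fullGrad (G.l i k y) w.z) = 0 ∧
    (∀ i j, G.h i j y w.x ≤ 0) ∧
    (∀ i k, G.l i k y w.x = 0) ∧
    (∀ i j, w.lam i j * G.h i j y w.z = 0) ∧
    (∀ i j, G.h i j y w.z ≤ 0) ∧
    (∀ i k, G.l i k y w.z = 0) ∧
    (∀ i j, 0 ≤ w.lam i j)}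

/-- The `1-1` Stackelberg game with one fictitious follower, who chooses `w = (x, z, λ, μ)` so as
to maximize `D(y, x)ᵀ (x - z)` over `Ω_F(y)`. -/
def toSingleFollower :
    SingleFollowerGame (EuclideanSpace ℝ (Fin nL)) (FollowerDecision n p q) where
  fL y w := G.fL y w.x
  fF y w := dot (G.pseudoGrad y w.x) (w.x - w.z)
  leaderSet := G.leaderSet
  followerSet := G.kktSet

/-- `-D(y, ·)` is strongly monotone on the set `s`. -/
def StronglyMonotoneNegGradOn (y : EuclideanSpace ℝ (Fin nL)) (s : Set (Profile n)) : Prop :=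
  ∃ c : ℝ, 0 < c ∧ ∀ x ∈ s, ∀ x' ∈ s,
    c * dot (x - x') (x - x') ≤ dot (-G.pseudoGrad y x - -G.pseudoGrad y x') (x - x')

/-- The linearized cone at `z` of the joint constraint system at the leader's decision `y`:
directions that are non-ascending for the active inequality constraints and stationary for the
equality constraints. -/
def linearizedCone (y : EuclideanSpace ℝ (Fin nL)) (z : Profile n) : Set (Profile n) :=
  {d | (∀ i j, G.h i j y z = 0 → dot (fullGrad (G.h i j y) z) d ≤ 0) ∧
    ∀ i k, dot (fullGrad (G.l i k y) z) d = 0}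

/-- Abadie's constraint qualification at `z`: every linearized direction is tangent to the joint
feasible set (in the sense of the Bouligand tangent cone). -/
def AbadieCQ (y : EuclideanSpace ℝ (Fin nL)) (z : Profile n) : Prop :=
  G.linearizedCone y z ⊆ posTangentConeAt (G.jointSet y) z

end MultiFollowerGame

end

end Stackelberg

/-!
Fix a decision `y` of the leader. A variational equilibrium `x` solves the linear problem of
maximizing `D(y, x)ᵀ z'` over `z' ∈ K(y)`; under Abadie's constraint qualification, Farkas' lemma
supplies multipliers making `(x, x, λ, μ)` feasible for the fictitious follower, with objective
value `0`. Conversely, as `K(y)` is convex, the KKT system makes `z` a minimizer of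
`D(y, x)ᵀ (x - z')` over `z' ∈ K(y)`, so the follower's objective is never positive (take `z' = x`),
and it vanishes only if `x` is a variational equilibrium. Hence the best responses project onto the
variational equilibria as soon as the maximum `0` is attained whenever `K(y)` is nonempty, and this
is the solvability of a strongly monotone variational inequality.
-/

open Filter Topology

section Farkas

variable {𝕜 V ι κ : Type*} [Field 𝕜] [LinearOrder 𝕜] [IsStrictOrderedRing 𝕜]
  [AddCommGroup V] [Module 𝕜 V]

theorem mem_hull_image_of_forall_nonpos (s : Finset ι) (a : ι → Module.Dual 𝕜 V)
    (b : Module.Dual 𝕜 V) (hab : ∀ v, (∀ i ∈ s, a i v ≤ 0) → b v ≤ 0) :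
    b ∈ PointedCone.hull 𝕜 (a '' s) := by
  classical
  induction s using Finset.induction_on generalizing a b with
  | empty =>
    have hb : b = 0 := LinearMap.ext fun v =>
      le_antisymm (hab v (by simp)) (by simpa using hab (-v) (by simp))
    exact hb ▸ zero_mem _
  | insert k s _ ih =>
    by_cases hs : ∀ v, (∀ i ∈ s, a i v ≤ 0) → b v ≤ 0
    · exact Submodule.span_mono (Set.image_mono (by simp)) (ih a b hs)
    push Not at hs
    obtain ⟨v₀, hv₀, hbv₀⟩ := hs
    have hkv₀ : 0 < a k v₀ := by
      contrapose! hbv₀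
      exact hab v₀ (by simpa using ⟨hbv₀, hv₀⟩)
    let C : PointedCone 𝕜 (Module.Dual 𝕜 V) := PointedCone.hull 𝕜 (a '' ↑(insert k s))
    have mem_C : ∀ i ∈ insert k s, a i ∈ C := fun i hi =>
      PointedCone.subset_hull (Set.mem_image_of_mem a hi)
    have smul_mem_C : ∀ {r : 𝕜}, 0 ≤ r → r • a k ∈ C := fun hr =>
      PointedCone.smul_mem _ hr (mem_C k (Finset.mem_insert_self k s))
    -- `proj g` is `g` precomposed with the projection of `V` onto `ker (a k)` along `v₀`.
    let proj (g : Module.Dual 𝕜 V) : Module.Dual 𝕜 V := g - (g v₀ / a k v₀) • a k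
    have proj_apply : ∀ g v, proj g v = g (v - (a k v / a k v₀) • v₀) := fun g v => by
      simp only [proj, LinearMap.sub_apply, LinearMap.smul_apply, map_sub, map_smul, smul_eq_mul]
      ring
    have hproj : proj b ∈ PointedCone.hull 𝕜 ((fun i => proj (a i)) '' s) := by
      refine ih _ _ fun v hv => ?_
      rw [proj_apply]
      refine hab _ (Finset.forall_mem_insert .. |>.2 ⟨?_, fun i hi => ?_⟩)
      · simp [hkv₀.ne']
      · rw [← proj_apply]
        exact hv i hi
    have hgen : (fun i => proj (a i)) '' s ⊆ C := by
      rintro _ ⟨i, hi, rfl⟩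
      have hproj_eq : proj (a i) = a i + (-a i v₀ / a k v₀) • a k := by
        simp only [proj]
        module
      change proj (a i) ∈ C
      rw [hproj_eq]
      exact add_mem (mem_C i (Finset.mem_insert_of_mem hi))
        (smul_mem_C (div_nonneg (neg_nonneg.2 (hv₀ i hi)) hkv₀.le))
    rw [← sub_add_cancel b ((b v₀ / a k v₀) • a k)]
    exact add_mem (Submodule.span_le.2 hgen hproj) (smul_mem_C (by positivity))

theorem exists_nonneg_eq_sum_smul_of_forall_nonpos [Fintype ι] (s : Set ι)
    (a : ι → Module.Dual 𝕜 V) (b : Module.Dual 𝕜 V)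
    (hab : ∀ v, (∀ i ∈ s, a i v ≤ 0) → b v ≤ 0) :
    ∃ c : ι → 𝕜, (∀ i, 0 ≤ c i) ∧ (∀ i ∉ s, c i = 0) ∧ b = ∑ i, c i • a i := by
  classical
  have hb := mem_hull_image_of_forall_nonpos s.toFinset a b (by simpa using hab)
  rw [Set.coe_toFinset] at hb
  obtain ⟨l, hl, rfl⟩ := (Finsupp.mem_span_image_iff_linearCombination _).1 hb
  refine ⟨fun i => l i, fun i => (l i).2, fun i hi => ?_, ?_⟩
  · simp [(Finsupp.mem_supported' _ l).1 hl i hi]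
  · rw [Finsupp.linearCombination_apply, Finsupp.sum_fintype _ _ fun i => zero_smul _ (a i)]
    rfl

theorem exists_multipliers_of_forall_nonpos [Fintype ι] [Fintype κ] (s : Set ι)
    (a : ι → Module.Dual 𝕜 V) (e : κ → Module.Dual 𝕜 V) (b : Module.Dual 𝕜 V)
    (hab : ∀ v, (∀ i ∈ s, a i v ≤ 0) → (∀ k, e k v = 0) → b v ≤ 0) :
    ∃ (c : ι → 𝕜) (m : κ → 𝕜), (∀ i, 0 ≤ c i) ∧ (∀ i ∉ s, c i = 0) ∧
      b = ∑ i, c i • a i + ∑ k, m k • e k := by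
  -- On the common kernel `p` of the `e k` only the inequalities remain.
  let p : Submodule 𝕜 V := ⨅ k, LinearMap.ker (e k)
  have mem_p : ∀ {v}, v ∈ p ↔ ∀ k, e k v = 0 := by simp [p]
  obtain ⟨c, hc, hcs, hbp⟩ := exists_nonneg_eq_sum_smul_of_forall_nonpos s
    (fun i => a i ∘ₗ p.subtype) (b ∘ₗ p.subtype) fun v hv => hab v hv (mem_p.1 v.2)
  have hker : p ≤ LinearMap.ker (b - ∑ i, c i • a i) := fun v hv => by
    simpa [sub_eq_zero] using LinearMap.congr_fun hbp ⟨v, hv⟩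
  obtain ⟨m, hm⟩ := (Submodule.mem_span_range_iff_exists_fun 𝕜).1
    (mem_span_of_iInf_ker_le_ker hker)
  exact ⟨c, m, hc, hcs, by rw [hm, add_sub_cancel]⟩

end Farkas

section VariationalInequality

variable {E : Type*} [NormedAddCommGroup E] [NormedSpace ℝ E]

/-- Strong monotonicity with modulus `c` on `K` of an operator from `E` to its dual, the operator
form of the monotonicity hypothesis on `-D(y, ·)`. -/
def StronglyMonotoneOn (c : ℝ) (F : E → StrongDual ℝ E) (K : Set E) : Prop :=
  ∀ x ∈ K, ∀ y ∈ K, c * ‖x - y‖ ^ 2 ≤ (F x - F y) (x - y)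

/-- The solution set of the (Stampacchia) variational inequality of the operator `F` over `K`. The
variational equilibria are the case `F = -D(y, ·)`, `K = K(y)`. -/
def variationalSolutions (F : E → StrongDual ℝ E) (K : Set E) : Set E :=
  {x | x ∈ K ∧ ∀ y ∈ K, 0 ≤ F x (y - x)}

variable {c : ℝ} {F : E → StrongDual ℝ E} {K : Set E}

theorem mem_variationalSolutions_of_minty (hK : Convex ℝ K)
    (hFc : ∀ v, ContinuousOn (fun x => F x v) K) {x : E} (hx : x ∈ K)
    (hminty : ∀ y ∈ K, 0 ≤ F y (y - x)) : x ∈ variationalSolutions F K := by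
  refine ⟨hx, fun y hy => ?_⟩
  let γ : ℝ → E := fun t => x + t • (y - x)
  have hγK : ∀ᶠ t in 𝓝[>] (0 : ℝ), γ t ∈ K := by
    filter_upwards [Ioc_mem_nhdsGT one_pos] with t ht
    exact hK.add_smul_sub_mem hx hy ⟨ht.1.le, ht.2⟩
  have hγ : Tendsto γ (𝓝[>] 0) (𝓝[K] x) := by
    refine tendsto_nhdsWithin_iff.2 ⟨?_, hγK⟩
    have hcont : Continuous γ := by fun_prop
    simpa [γ] using (hcont.tendsto 0).mono_left nhdsWithin_le_nhds
  refine ge_of_tendsto ((hFc (y - x) x hx).tendsto.comp hγ) ?_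
  filter_upwards [hγK, self_mem_nhdsWithin] with t htK (ht : 0 < t)
  have h := hminty (γ t) htK
  simp only [γ, add_sub_cancel_left, map_smul, smul_eq_mul] at h
  exact nonneg_of_mul_nonneg_right h ht

theorem concaveOn_minty_gap (f : StrongDual ℝ E) (hc : 0 ≤ c) (y : E) :
    ConcaveOn ℝ Set.univ fun x => f (y - x) - c * ‖y - x‖ ^ 2 := by
  have hlin : ConcaveOn ℝ Set.univ fun x => f (y - x) := by
    simp only [map_sub]
    exact (concaveOn_const _ convex_univ).sub (f.toLinearMap.convexOn convex_univ)
  have hsq : ConvexOn ℝ Set.univ fun x => ‖y - x‖ ^ 2 := by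
    simp only [← dist_eq_norm_sub']
    exact (convexOn_dist y convex_univ).pow (fun _ _ => dist_nonneg) 2
  exact hlin.sub (hsq.smul hc)

theorem StronglyMonotoneOn.sum_minty_gap_centroid_nonneg (hF : StronglyMonotoneOn c F K)
    (hK : Convex ℝ K) {u : Finset E} (huK : ↑u ⊆ K) {s : u → ℝ} (hs : s ∈ stdSimplex ℝ u) :
    0 ≤ ∑ y, s y * (F y (y - ∑ z, s z • (z : E)) - c * ‖(y : E) - ∑ z, s z • (z : E)‖ ^ 2) := by
  set x : E := ∑ z, s z • (z : E)
  have hxK : x ∈ K := hK.sum_mem (fun z _ => hs.1 z) hs.2 fun z _ => huK z.2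
  have hcentroid : ∑ y, s y * F x (y - x) = 0 := by
    simp_rw [← smul_eq_mul, ← map_smul, ← map_sum, smul_sub, Finset.sum_sub_distrib]
    rw [← Finset.sum_smul, hs.2, one_smul, sub_self, map_zero]
  rw [← hcentroid]
  refine Finset.sum_le_sum fun y _ => mul_le_mul_of_nonneg_left ?_ (hs.1 y)
  have h := hF y (huK y.2) x hxK
  rw [sub_apply] at h
  linarith

theorem StronglyMonotoneOn.exists_mem_convexHull_forall_minty (hF : StronglyMonotoneOn c F K)
    (hc : 0 ≤ c) (hK : Convex ℝ K) {u : Finset E} (hu : u.Nonempty) (huK : ↑u ⊆ K) :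
    ∃ x ∈ convexHull ℝ (u : Set E), ∀ y ∈ u, c * ‖y - x‖ ^ 2 ≤ F y (y - x) := by
  classical
  have := hu.to_subtype
  let gap (y x : E) : ℝ := F y (y - x) - c * ‖y - x‖ ^ 2
  let payoff (s : u → ℝ) (x : E) : ℝ := ∑ y, s y * gap y x
  have gap_continuous : ∀ y, Continuous (gap y) := fun y => by fun_prop
  have gap_concave : ∀ y, ConcaveOn ℝ (convexHull ℝ (u : Set E)) (gap y) := fun y =>
    (concaveOn_minty_gap (F y) hc y).subset (Set.subset_univ _) (convex_convexHull ℝ _)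
  obtain ⟨s, hs, x, hx, hsaddle⟩ : ∃ s ∈ stdSimplex ℝ u, ∃ x ∈ convexHull ℝ (u : Set E),
      IsSaddlePointOn (stdSimplex ℝ u) (convexHull ℝ (u : Set E)) payoff s x := by
    refine Sion.exists_isSaddlePointOn ⟨_, single_mem_stdSimplex ℝ (Classical.arbitrary u)⟩
      (convex_stdSimplex ℝ u) (isCompact_stdSimplex ℝ u)
      (fun x _ => Continuous.lowerSemicontinuous (by fun_prop) |>.lowerSemicontinuousOn _) ?_
      (convex_convexHull ℝ _) (hu.to_set.convexHull) (u.finite_toSet.isCompact_convexHull ℝ)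
      (fun s _ => Continuous.upperSemicontinuous (by fun_prop) |>.upperSemicontinuousOn _) ?_
    · exact fun x _ => ((Fintype.linearCombination ℝ fun y : u => gap y x).convexOn
        (convex_stdSimplex ℝ u)).quasiconvexOn
    · intro s hs
      have hpayoff : payoff s = ∑ y, s y • gap y := by
        ext x
        simp [payoff]
      rw [hpayoff]
      exact (Finset.sum_induction (fun y => s y • gap y) (ConcaveOn ℝ _) (fun _ _ => ConcaveOn.add)
        (concaveOn_const 0 (convex_convexHull ℝ _))
        fun y _ => (gap_concave y).smul (hs.1 y)).quasiconcaveOn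
  refine ⟨x, hx, fun y hy => ?_⟩
  -- The saddle value is nonnegative: against `s`, the point `x` may move to the centroid of `s`.
  have hvalue : 0 ≤ payoff s (∑ z, s z • (z : E)) := hF.sum_minty_gap_centroid_nonneg hK huK hs
  have hcentroid : ∑ z, s z • (z : E) ∈ convexHull ℝ (u : Set E) :=
    (convex_convexHull ℝ _).sum_mem (fun z _ => hs.1 z) hs.2 fun z _ => subset_convexHull ℝ _ z.2
  have h := hvalue.trans (hsaddle _ (single_mem_stdSimplex ℝ ⟨y, hy⟩) _ hcentroid)
  simpa [payoff, gap, Pi.single_apply] using h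

theorem StronglyMonotoneOn.variationalSolutions_nonempty [ProperSpace E]
    (hF : StronglyMonotoneOn c F K) (hc : 0 < c) (hFc : ∀ v, ContinuousOn (fun x => F x v) K)
    (hK : Convex ℝ K) (hclosed : IsClosed K) (hne : K.Nonempty) :
    (variationalSolutions F K).Nonempty := by
  classical
  obtain ⟨x₀, hx₀⟩ := hne
  let mintySet (y : E) : Set E := {x | c * ‖y - x‖ ^ 2 ≤ F y (y - x)}
  have isClosed_mintySet : ∀ y, IsClosed (mintySet y) := fun y =>
    isClosed_le (by fun_prop) (by fun_prop)
  have mintySet_subset : mintySet x₀ ⊆ Metric.closedBall x₀ (‖F x₀‖ / c) := fun x hx => by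
    rw [mem_closedBall_iff_norm', le_div_iff₀' hc]
    have hle : c * ‖x₀ - x‖ ^ 2 ≤ ‖F x₀‖ * ‖x₀ - x‖ :=
      (show c * ‖x₀ - x‖ ^ 2 ≤ F x₀ (x₀ - x) from hx).trans <| (le_abs_self _).trans <|
        (F x₀).le_opNorm _
    rcases (norm_nonneg (x₀ - x)).eq_or_lt with hzero | hpos
    · rw [← hzero, mul_zero]
      exact norm_nonneg _
    · exact le_of_mul_le_mul_right (by linarith [sq ‖x₀ - x‖]) hpos
  have hcompact : IsCompact (K ∩ mintySet x₀) :=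
    (isCompact_closedBall _ _).of_isClosed_subset (hclosed.inter (isClosed_mintySet x₀))
      (Set.inter_subset_right.trans mintySet_subset)
  obtain ⟨x, ⟨hxK, -⟩, hx⟩ : (K ∩ mintySet x₀ ∩ ⋂ y : K, mintySet y).Nonempty := by
    refine hcompact.inter_iInter_nonempty _ (fun y => isClosed_mintySet y) fun u => ?_
    have huK : ↑(insert x₀ (u.image Subtype.val)) ⊆ K := by
      simp [Set.insert_subset_iff, hx₀]
    obtain ⟨x, hx, hminty⟩ :=
      hF.exists_mem_convexHull_forall_minty hc.le hK (Finset.insert_nonempty _ _) huK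
    refine ⟨x, ⟨convexHull_min huK hK hx, hminty x₀ (by simp)⟩, ?_⟩
    exact Set.mem_iInter₂.2 fun y hy => hminty y (by simp [show y ∈ u from hy])
  refine ⟨x, mem_variationalSolutions_of_minty hK hFc hxK fun y hy => ?_⟩
  exact (by positivity : 0 ≤ c * ‖y - x‖ ^ 2).trans (Set.mem_iInter.1 hx ⟨y, hy⟩)

theorem nonneg_of_mem_variationalSolutions {x d : E} (hx : x ∈ variationalSolutions F K)
    (hd : d ∈ posTangentConeAt K x) : 0 ≤ F x d := by
  refine IsLocalMinOn.hasFDerivWithinAt_nonneg ?_ (F x).hasFDerivWithinAt hd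
  exact eventually_nhdsWithin_of_forall fun y hy => by simpa using hx.2 y hy

end VariationalInequality

namespace Stackelberg

section Dot

variable {N : ℕ} {n : Fin N → ℕ}

/-- The pairing `dot` as a continuous bilinear form. The norm of `Profile n` is a supremum of
Euclidean norms, so this is not the inner product of an `InnerProductSpace` structure. It turns
`D(y, ·)` into an operator with values in the dual. -/
noncomputable def dotForm (n : Fin N → ℕ) : Profile n →L[ℝ] StrongDual ℝ (Profile n) :=
  ∑ i, (innerSL ℝ).bilinearComp (ContinuousLinearMap.proj i) (ContinuousLinearMap.proj i)

theorem dotForm_apply (u v : Profile n) : dotForm n u v = dot u v := by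
  simp [dotForm, dot]

theorem dot_neg_left (u v : Profile n) : dot (-u) v = -dot u v := by
  simp only [← dotForm_apply, map_neg, neg_apply]

theorem dot_neg_right (u v : Profile n) : dot u (-v) = -dot u v := by
  simp only [← dotForm_apply, map_neg]

theorem dot_sub_right (u v v' : Profile n) : dot u (v - v') = dot u v - dot u v' := by
  simp only [← dotForm_apply, map_sub]

theorem sq_norm_le_dot_self (d : Profile n) : ‖d‖ ^ 2 ≤ dot d d := by
  refine (Real.le_sqrt (norm_nonneg d) (Finset.sum_nonneg fun _ _ => real_inner_self_nonneg)).1 ?_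
  refine (pi_norm_le_iff_of_nonneg (Real.sqrt_nonneg _)).2 fun i => Real.le_sqrt_of_sq_le ?_
  rw [← real_inner_self_eq_norm_sq]
  exact Finset.single_le_sum (f := fun j => inner ℝ (d j) (d j))
    (fun _ _ => real_inner_self_nonneg) (Finset.mem_univ i)

theorem dotForm_injective : Function.Injective (dotForm n) := by
  refine (injective_iff_map_eq_zero _).2 fun u hu => ?_
  have hdot : dot u u = 0 := by rw [← dotForm_apply, hu, zero_apply]
  have hnorm : ‖u‖ ^ 2 = 0 := le_antisymm (hdot ▸ sq_norm_le_dot_self u) (sq_nonneg _)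
  simpa using hnorm

theorem partialGrad_eq_toDual_symm {g : Profile n → ℝ} {x : Profile n}
    (hg : DifferentiableAt ℝ g x) (i : Fin N) :
    partialGrad g x i = (InnerProductSpace.toDual ℝ _).symm
      (fderiv ℝ g x ∘L ContinuousLinearMap.single ℝ (fun i => EuclideanSpace ℝ (Fin (n i))) i) := by
  have hg' : HasFDerivAt g (fderiv ℝ g x) (Function.update x i (x i)) := by
    rw [Function.update_eq_self]
    exact hg.hasFDerivAt
  have hsingle : ContinuousLinearMap.pi (φ := fun i => EuclideanSpace ℝ (Fin (n i)))
        (Pi.single i (.id ℝ _)) =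
      ContinuousLinearMap.single ℝ (fun i => EuclideanSpace ℝ (Fin (n i))) i := by
    ext v j : 2
    rcases eq_or_ne j i with rfl | hj
    · simp
    · simp [hj]
  rw [partialGrad, gradient, ← hsingle]
  exact congrArg _ (hg'.comp (x i) (hasFDerivAt_update x (x i))).fderiv

theorem dot_fullGrad {g : Profile n → ℝ} {x : Profile n} (hg : DifferentiableAt ℝ g x)
    (d : Profile n) : dot (fullGrad g x) d = fderiv ℝ g x d := by
  simp only [dot, fullGrad, partialGrad_eq_toDual_symm hg,
    InnerProductSpace.toDual_symm_apply, ContinuousLinearMap.comp_apply,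
    ContinuousLinearMap.single_apply]
  rw [← map_sum, Finset.univ_sum_single]

end Dot

namespace MultiFollowerGame

variable {N nL pL qL : ℕ} {n p q : Fin N → ℕ} {G : MultiFollowerGame N nL pL qL n p q}
  {y : EuclideanSpace ℝ (Fin nL)}

theorem mem_jointSet {x : Profile n} :
    x ∈ G.jointSet y ↔ (∀ i j, G.h i j y x ≤ 0) ∧ ∀ i k, G.l i k y x = 0 := by
  simp [jointSet, strategySet, forall_and]

theorem isClosed_jointSet (hh : ∀ i j, Continuous (G.h i j y))
    (hl : ∀ i k, Continuous (G.l i k y)) : IsClosed (G.jointSet y) := by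
  have heq : G.jointSet y =
      (⋂ i, ⋂ j, {x | G.h i j y x ≤ 0}) ∩ ⋂ i, ⋂ k, {x | G.l i k y x = 0} := by
    ext x
    simp [mem_jointSet]
  rw [heq]
  exact (isClosed_iInter fun i => isClosed_iInter fun j =>
    isClosed_le (hh i j) continuous_const).inter
      (isClosed_iInter fun i => isClosed_iInter fun k => isClosed_eq (hl i k) continuous_const)

theorem continuousOn_pseudoGrad {s : Set (Profile n)}
    (hf : ∀ x ∈ s, ∀ i, ContDiffAt ℝ 1 (G.f i y) x) : ContinuousOn (G.pseudoGrad y) s := by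
  refine continuousOn_pi.2 fun i => ContinuousOn.congr (fun x hx => ?_) fun x hx =>
    partialGrad_eq_toDual_symm ((hf x hx i).differentiableAt one_ne_zero) i
  have hfderiv : ContinuousAt (fderiv ℝ (G.f i y)) x :=
    ((hf x hx i).fderiv_right (m := 0) (by simp)).continuousAt
  exact ((InnerProductSpace.toDual ℝ _).symm.continuous.continuousAt.comp
    (hfderiv.clm_comp continuousAt_const)).continuousWithinAt

theorem variationalEquilibria_eq_variationalSolutions :
    G.variationalEquilibria y =
      variationalSolutions (fun x => -dotForm n (G.pseudoGrad y x)) (G.jointSet y) := by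
  ext x
  refine and_congr_right fun _ => forall₂_congr fun x' _ => ?_
  rw [neg_apply, dotForm_apply, ← dot_neg_right, neg_sub]

theorem StronglyMonotoneNegGradOn.exists_stronglyMonotoneOn {s : Set (Profile n)}
    (hmono : G.StronglyMonotoneNegGradOn y s) :
    ∃ c, 0 < c ∧ StronglyMonotoneOn c (fun x => -dotForm n (G.pseudoGrad y x)) s := by
  obtain ⟨c, hc, hmono⟩ := hmono
  refine ⟨c, hc, fun x hx x' hx' => ?_⟩
  calc c * ‖x - x'‖ ^ 2 ≤ c * dot (x - x') (x - x') := by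
        gcongr
        exact sq_norm_le_dot_self _
    _ ≤ dot (-G.pseudoGrad y x - -G.pseudoGrad y x') (x - x') := hmono x hx x' hx'
    _ = _ := by simp only [← dotForm_apply, map_sub, map_neg]

theorem variationalEquilibria_nonempty (hD : ContinuousOn (G.pseudoGrad y) (G.jointSet y))
    (hjoint : Convex ℝ (G.jointSet y)) (hclosed : IsClosed (G.jointSet y))
    (hmono : G.StronglyMonotoneNegGradOn y (G.jointSet y)) (hne : (G.jointSet y).Nonempty) :
    (G.variationalEquilibria y).Nonempty := by
  obtain ⟨c, hc, hF⟩ := hmono.exists_stronglyMonotoneOn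
  rw [variationalEquilibria_eq_variationalSolutions]
  exact hF.variationalSolutions_nonempty hc (fun v => by fun_prop) hjoint hclosed hne

theorem posTangentConeAt_jointSet_subset_linearizedCone {z : Profile n}
    (hh : ∀ i j, DifferentiableAt ℝ (G.h i j y) z) (hl : ∀ i k, DifferentiableAt ℝ (G.l i k y) z)
    (hz : z ∈ G.jointSet y) : posTangentConeAt (G.jointSet y) z ⊆ G.linearizedCone y z := by
  intro d hd
  refine ⟨fun i j hact => ?_, fun i k => ?_⟩
  · rw [dot_fullGrad (hh i j)]
    have hmax : IsLocalMaxOn (G.h i j y) (G.jointSet y) z :=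
      eventually_nhdsWithin_of_forall fun x hx => by
        rw [hact]
        exact (mem_jointSet.1 hx).1 i j
    exact hmax.hasFDerivWithinAt_nonpos (hh i j).hasFDerivAt.hasFDerivWithinAt hd
  · rw [dot_fullGrad (hl i k)]
    have hconst : ∀ x ∈ G.jointSet y, G.l i k y x = G.l i k y z := fun x hx => by
      rw [(mem_jointSet.1 hx).2, (mem_jointSet.1 hz).2]
    have hmax : IsLocalMaxOn (G.l i k y) (G.jointSet y) z :=
      eventually_nhdsWithin_of_forall fun x hx => (hconst x hx).le
    have hmin : IsLocalMinOn (G.l i k y) (G.jointSet y) z :=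
      eventually_nhdsWithin_of_forall fun x hx => (hconst x hx).ge
    have hfderiv := (hl i k).hasFDerivAt.hasFDerivWithinAt (s := G.jointSet y)
    exact le_antisymm (hmax.hasFDerivWithinAt_nonpos hfderiv hd)
      (hmin.hasFDerivWithinAt_nonneg hfderiv hd)

theorem mem_jointSet_of_mem_kktSet {w : FollowerDecision n p q} (hw : w ∈ G.kktSet y) :
    w.x ∈ G.jointSet y ∧ w.z ∈ G.jointSet y := by
  obtain ⟨-, hhx, hlx, -, hhz, hlz, -⟩ := hw
  exact ⟨mem_jointSet.2 ⟨hhx, hlx⟩, mem_jointSet.2 ⟨hhz, hlz⟩⟩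

theorem dot_pseudoGrad_nonpos_of_mem_kktSet {w : FollowerDecision n p q} (hw : w ∈ G.kktSet y)
    {d : Profile n} (hd : d ∈ G.linearizedCone y w.z) : dot (G.pseudoGrad y w.x) d ≤ 0 := by
  obtain ⟨hstat, -, -, hcomp, -, -, hnonneg⟩ := hw
  have hstat_d : -dot (G.pseudoGrad y w.x) d +
      ∑ i, ∑ j, w.lam i j * dot (fullGrad (G.h i j y) w.z) d = 0 := by
    have h := congrArg (fun u => dotForm n u d) hstat
    simpa [dotForm_apply, dot_neg_left, hd.2] using h
  have hterm : ∀ i j, w.lam i j * dot (fullGrad (G.h i j y) w.z) d ≤ 0 := fun i j => by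
    rcases mul_eq_zero.1 (hcomp i j) with hlam | hact
    · rw [hlam, zero_mul]
    · exact mul_nonpos_of_nonneg_of_nonpos (hnonneg i j) (hd.1 i j hact)
  have hsum := Finset.sum_nonpos fun i (_ : i ∈ Finset.univ) =>
    Finset.sum_nonpos fun j (_ : j ∈ Finset.univ) => hterm i j
  linarith

theorem dot_sub_z_le_of_mem_kktSet {w : FollowerDecision n p q} (hw : w ∈ G.kktSet y)
    (hh : ∀ i j, DifferentiableAt ℝ (G.h i j y) w.z)
    (hl : ∀ i k, DifferentiableAt ℝ (G.l i k y) w.z) (hjoint : Convex ℝ (G.jointSet y))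
    {z' : Profile n} (hz' : z' ∈ G.jointSet y) :
    dot (G.pseudoGrad y w.x) (w.x - w.z) ≤ dot (G.pseudoGrad y w.x) (w.x - z') := by
  have hz := (mem_jointSet_of_mem_kktSet hw).2
  have htan : z' - w.z ∈ posTangentConeAt (G.jointSet y) w.z :=
    sub_mem_posTangentConeAt_of_segment_subset (hjoint.segment_subset hz hz')
  have hdot := dot_pseudoGrad_nonpos_of_mem_kktSet hw
    (posTangentConeAt_jointSet_subset_linearizedCone hh hl hz htan)
  rw [dot_sub_right] at hdot ⊢
  rw [dot_sub_right]
  linarith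

theorem dot_pseudoGrad_nonpos_of_mem_posTangentConeAt {x d : Profile n}
    (hx : x ∈ G.variationalEquilibria y) (hd : d ∈ posTangentConeAt (G.jointSet y) x) :
    dot (G.pseudoGrad y x) d ≤ 0 := by
  rw [variationalEquilibria_eq_variationalSolutions] at hx
  simpa [dotForm_apply] using nonneg_of_mem_variationalSolutions hx hd

theorem exists_mem_kktSet_of_mem_variationalEquilibria {x : Profile n}
    (hx : x ∈ G.variationalEquilibria y) (hCQ : G.AbadieCQ y x) :
    ∃ lam mu, (⟨x, x, lam, mu⟩ : FollowerDecision n p q) ∈ G.kktSet y := by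
  obtain ⟨c, m, hc, hc₀, hsum⟩ := exists_multipliers_of_forall_nonpos
    {r : Σ i, Fin (p i) | G.h r.1 r.2 y x = 0}
    (fun r => (dotForm n (fullGrad (G.h r.1 r.2 y) x)).toLinearMap)
    (fun r : Σ i, Fin (q i) => (dotForm n (fullGrad (G.l r.1 r.2 y) x)).toLinearMap)
    (dotForm n (G.pseudoGrad y x)).toLinearMap fun d hd_h hd_l => by
      simp only [ContinuousLinearMap.coe_coe, dotForm_apply, Sigma.forall] at hd_h hd_l ⊢
      exact dot_pseudoGrad_nonpos_of_mem_posTangentConeAt hx (hCQ ⟨hd_h, hd_l⟩)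
  have hgrad : G.pseudoGrad y x = (∑ i, ∑ j, c ⟨i, j⟩ • fullGrad (G.h i j y) x) +
      ∑ i, ∑ k, m ⟨i, k⟩ • fullGrad (G.l i k y) x := by
    refine dotForm_injective (ContinuousLinearMap.coe_injective ?_)
    rw [hsum, Fintype.sum_sigma, Fintype.sum_sigma]
    ext d
    simp
  obtain ⟨hhx, hlx⟩ := mem_jointSet.1 hx.1
  refine ⟨fun i j => c ⟨i, j⟩, fun i k => m ⟨i, k⟩, ?_, hhx, hlx, fun i j => ?_, hhx, hlx,
    fun i j => hc ⟨i, j⟩⟩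
  · dsimp only
    rw [add_assoc, ← hgrad, neg_add_cancel]
  · by_cases hact : G.h i j y x = 0
    · exact mul_eq_zero_of_right _ hact
    · exact mul_eq_zero_of_left (hc₀ ⟨i, j⟩ hact) _

theorem image_x_bestResponses (hD : ContinuousOn (G.pseudoGrad y) (G.jointSet y))
    (hjoint : Convex ℝ (G.jointSet y)) (hmono : G.StronglyMonotoneNegGradOn y (G.jointSet y))
    (hh : ∀ i j, Differentiable ℝ (G.h i j y)) (hl : ∀ i k, Differentiable ℝ (G.l i k y))
    (hCQ : ∀ z ∈ G.jointSet y, G.AbadieCQ y z) :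
    FollowerDecision.x '' G.toSingleFollower.bestResponses y = G.variationalEquilibria y := by
  have hle : ∀ w ∈ G.kktSet y, ∀ z' ∈ G.jointSet y,
      dot (G.pseudoGrad y w.x) (w.x - w.z) ≤ dot (G.pseudoGrad y w.x) (w.x - z') :=
    fun w hw z' hz' => dot_sub_z_le_of_mem_kktSet hw (fun i j => hh i j w.z)
      (fun i k => hl i k w.z) hjoint hz'
  have hclosed : IsClosed (G.jointSet y) :=
    isClosed_jointSet (fun i j => (hh i j).continuous) fun i k => (hl i k).continuous
  refine Set.Subset.antisymm ?_ fun x hx => ?_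
  · rintro _ ⟨w, ⟨hw, hmax⟩, rfl⟩
    have hwx := (mem_jointSet_of_mem_kktSet hw).1
    obtain ⟨v, hv⟩ := variationalEquilibria_nonempty hD hjoint hclosed hmono ⟨w.x, hwx⟩
    obtain ⟨lam, mu, hv_kkt⟩ := exists_mem_kktSet_of_mem_variationalEquilibria hv (hCQ v hv.1)
    have hvalue : 0 ≤ dot (G.pseudoGrad y w.x) (w.x - w.z) := by
      simpa [toSingleFollower, dot] using hmax _ hv_kkt
    exact ⟨hwx, fun x' hx' => hvalue.trans (hle w hw x' hx')⟩
  · obtain ⟨lam, mu, hx_kkt⟩ := exists_mem_kktSet_of_mem_variationalEquilibria hx (hCQ x hx.1)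
    refine ⟨_, ⟨hx_kkt, fun w hw => ?_⟩, rfl⟩
    simpa [toSingleFollower, dot] using hle w hw w.x (mem_jointSet_of_mem_kktSet hw).1

theorem variationalStackelbergEquilibria_eq_image
    (himage : ∀ y ∈ G.leaderSet,
      FollowerDecision.x '' G.toSingleFollower.bestResponses y = G.variationalEquilibria y) :
    G.variationalStackelbergEquilibria =
      (fun e => (e.1, e.2.x)) '' G.toSingleFollower.stackelbergEquilibria := by
  have hinf : ∀ y ∈ G.leaderSet, (⨅ v ∈ G.variationalEquilibria y, (G.fL y v : EReal)) =
      ⨅ w ∈ G.toSingleFollower.bestResponses y, (G.toSingleFollower.fL y w : EReal) :=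
    fun y hy => by
      rw [← himage y hy, iInf_image]
      rfl
  have hsup : ∀ y ∈ G.leaderSet, (⨆ v ∈ G.variationalEquilibria y, (G.fL y v : EReal)) =
      ⨆ w ∈ G.toSingleFollower.bestResponses y, (G.toSingleFollower.fL y w : EReal) :=
    fun y hy => by
      rw [← himage y hy, iSup_image]
      rfl
  ext ⟨y, x⟩
  constructor
  · rintro ⟨hy, hx, hopt⟩
    obtain ⟨w, hw, rfl⟩ := (himage y hy).superset hx
    refine ⟨(y, w), ⟨hy, hw, fun y' hy' => ?_⟩, rfl⟩
    rw [← hinf y' hy', ← hsup y hy]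
    exact hopt y' hy'
  · rintro ⟨⟨y, w⟩, ⟨hy, hw, hopt⟩, ⟨⟩⟩
    refine ⟨hy, (himage y hy).subset ⟨w, hw, rfl⟩, fun y' hy' => ?_⟩
    rw [hinf y' hy', hsup y hy]
    exact hopt y' hy'

end MultiFollowerGame

end Stackelberg

theorem theorem4_general {N nL pL qL : ℕ} {n p q : Fin N → ℕ}
    (G : Stackelberg.MultiFollowerGame N nL pL qL n p q)
    (hD : ∀ y ∈ G.leaderSet, ContinuousOn (G.pseudoGrad y) (G.jointSet y))
    (hjoint : ∀ y ∈ G.leaderSet, Convex ℝ (G.jointSet y))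
    (hmono : ∀ y ∈ G.leaderSet, G.StronglyMonotoneNegGradOn y (G.jointSet y))
    (hdiff_h : ∀ y ∈ G.leaderSet, ∀ i j, Differentiable ℝ (G.h i j y))
    (hdiff_l : ∀ y ∈ G.leaderSet, ∀ i k, Differentiable ℝ (G.l i k y))
    (hCQ : ∀ y ∈ G.leaderSet, ∀ z ∈ G.jointSet y, G.AbadieCQ y z) :
    G.variationalStackelbergEquilibria =
      (fun e => (e.1, e.2.x)) '' G.toSingleFollower.stackelbergEquilibria :=
  Stackelberg.MultiFollowerGame.variationalStackelbergEquilibria_eq_image fun y hy =>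
    Stackelberg.MultiFollowerGame.image_x_bestResponses (hD y hy) (hjoint y hy) (hmono y hy)
      (hdiff_h y hy) (hdiff_l y hy) (hCQ y hy)

theorem theorem4 {N nL pL qL : ℕ} {n p q : Fin N → ℕ}
    (G : Stackelberg.MultiFollowerGame N nL pL qL n p q)
    -- each `Ωᵢ(y, x₋ᵢ)` is closed and convex
    (hclosed : ∀ y ∈ G.leaderSet, ∀ x ∈ G.jointSet y, ∀ i, IsClosed (G.strategySet i y x))
    (hconvex : ∀ y ∈ G.leaderSet, ∀ x ∈ G.jointSet y, ∀ i, Convex ℝ (G.strategySet i y x))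
    -- each `fᵢ` is concave in `xᵢ` on `Ωᵢ(y, x₋ᵢ)`, and `C¹` in `x` near the joint feasible set
    (hconcave : ∀ y ∈ G.leaderSet, ∀ x ∈ G.jointSet y, ∀ i,
      ConcaveOn ℝ (G.strategySet i y x) (fun u => G.f i y (Function.update x i u)))
    (hC1 : ∀ y ∈ G.leaderSet, ∀ x ∈ G.jointSet y, ∀ i, ContDiffAt ℝ 1 (G.f i y) x)
    -- the joint feasible set is convex
    (hjoint : ∀ y ∈ G.leaderSet, Convex ℝ (G.jointSet y))
    -- `-D(y, ·)` is strongly monotone on the joint feasible set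
    (hmono : ∀ y ∈ G.leaderSet, G.StronglyMonotoneNegGradOn y (G.jointSet y))
    -- the followers' constraints are differentiable in `x` and satisfy a constraint qualification
    (hdiff_h : ∀ y ∈ G.leaderSet, ∀ i j, Differentiable ℝ (G.h i j y))
    (hdiff_l : ∀ y ∈ G.leaderSet, ∀ i k, Differentiable ℝ (G.l i k y))
    (hCQ : ∀ y ∈ G.leaderSet, ∀ z ∈ G.jointSet y, G.AbadieCQ y z) :
    G.variationalStackelbergEquilibria =
      (fun e => (e.1, e.2.x)) '' G.toSingleFollower.stackelbergEquilibria :=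
  theorem4_general G
    (fun y hy => Stackelberg.MultiFollowerGame.continuousOn_pseudoGrad (hC1 y hy))
    hjoint hmono hdiff_h hdiff_l hCQ
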